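/- **Setting.** Let $S$ and $F$ be finite-dimensional complex Hilbert spaces. Write $\mathcal L(X)$ for the linear operators on $X$, and regard $M\in\mathcal L(S)$ as the operator $M\otimes I_F$ on $S\otimes F$ where needed. For a unitary $U:S\otimes F\to T\otimes G$ between tensor products of finite-dimensional Hilbert spaces, an operator $K$ on $S\otimes F$ *influences $G$ through $U$* if $[U^\dagger (I_T\otimes N)U,\,K]\neq 0$ for some $N\in\mathcal L(G)$. An operator $M\in\mathcal L(S)$ is *accessible to $G$ by $U$* if every $K\in\mathcal L(S)$ with $[M,K]\ne 0$ influences $G$ through $U$. It is *left potentially accessible after $U$* if there are finite-dimensional systems $H',R,I$ and a unitary $V:T\otimes H'\to R\otimes I$ such that $M\otimes I_F$ is accessible to $I$ by the interaction "$U$ followed by $V$", viewed as a bipartite interaction $(S\otimes F)\otimes H'\to (R\otimes G)\otimes I$. Let $S_{\rm pacc}^U$ be the set of such $M$. Let $H$ be a Hermitian operator on $S\otimes F$ (a time-independent Hamiltonian), $U_t=e^{-iHt}$ and $\mathcal U_t(X)=U_tXU_t^\dagger$ for $t\in\mathbb R$. Define - $S_{\rm pacc}^H=\bigcap_{t\in\mathbb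 R}S_{\rm pacc}^{U_t}$ (potentially accessible operators), - $S_{\rm acc}^H=\{M\in\mathcal L(S): [M,N]=0\ \text{for all } N\in S_{\rm pacc}^H\}$ (accessible operators), - $S_{\rm dec}^H=S_{\rm acc}^H\cap S_{\rm pacc}^H$ (decohered operators), - $S_{\rm rob}^H=\{M\in\mathcal L(S):[M\otimes I_F,H]=0\}$ (robust operators). $H$ is *maximally decohering* if $S_{\rm dec}^H$ contains a nondegenerate observable, i.e. a Hermitian operator all of whose eigenspaces have dimension at most one. **Theorem.** 1. An operator on $S$ is decohered if and only if it is both accessible and robust: $S_{\rm dec}^H=S_{\rm acc}^H\cap S_{\rm rob}^H$. Here also $S_{\rm rob}^H=\{M\in\mathcal L(S): \mathcal U_t(M\otimes I_F)=M\otimes I_F\ \text{for all } t\in\mathbb R\}$. 2. $H$ is maximally decohering if and only if there are an orthonormal basis $(\psi_k)_k$ of $S$ and Hermitian operators $H_F^{(k)}$ on $F$ with $$H=\sum_k |\psi_k\rangle\langle\psi_k|\otimes H_F^{(k)},$$ such that for all $k\ne l$ the difference $H_F^{(k)}-H_F^{(l)}$ is not a scalar multiple (including zero) of $I_F$. 3.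 If $H$ is maximally decohering, the control basis is unique up to phases and ordering: if $H=\sum_k |\psi_k\rangle\langle\psi_k|\otimes H_F^{(k)}=\sum_k |\psi'_k\rangle\langle\psi'_k|\otimes H_F'^{(k)}$ with orthonormal bases $(\psi_k)_k$, $(\psi'_k)_k$ of $S$ and Hermitian operators $H_F^{(k)}$, $H_F'^{(k)}$ on $F$, then there are a permutation $\sigma$ and complex numbers $c_k$ with $|c_k|=1$ such that $\psi'_k=c_k\psi_{\sigma(k)}$ for all $k$. -/

import Mathlib

open scoped TensorProduct

namespace Decoherence

noncomputable section

/-! The operators on a system `A` with finite-dimensional Hilbert space `A` are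
`Module.End ℂ A`. The composite of `A` and `B` has Hilbert space `A ⊗[ℂ] B`, with Mathlib's inner
product on the tensor product. -/

section Discrete

variable {S F T G H R I : Type*}
  [NormedAddCommGroup S] [InnerProductSpace ℂ S]
  [NormedAddCommGroup F] [InnerProductSpace ℂ F]
  [NormedAddCommGroup T] [InnerProductSpace ℂ T]
  [NormedAddCommGroup G] [InnerProductSpace ℂ G]
  [NormedAddCommGroup H] [InnerProductSpace ℂ H]
  [NormedAddCommGroup R] [InnerProductSpace ℂ R]
  [NormedAddCommGroup I] [InnerProductSpace ℂ I]

/-- The operator `M ⊗ 1` on the composite system, for an operator `M` on the left factor. -/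
def onLeft (F : Type*) [NormedAddCommGroup F] [InnerProductSpace ℂ F]
    (M : Module.End ℂ S) : Module.End ℂ (S ⊗[ℂ] F) :=
  TensorProduct.map M LinearMap.id

/-- The operator `1 ⊗ N` on the composite system, for an operator `N` on the right factor. -/
def onRight (S : Type*) [NormedAddCommGroup S] [InnerProductSpace ℂ S]
    (N : Module.End ℂ F) : Module.End ℂ (S ⊗[ℂ] F) :=
  TensorProduct.map LinearMap.id N

/-- The unitary channel `M ↦ U M U†` of a unitary map `U`. Its inverse is the channel of
`U.symm`. -/
def channel (U : S ≃ₗᵢ[ℂ] T) (M : Module.End ℂ S) : Module.End ℂ T :=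
  U.toLinearEquiv.toLinearMap ∘ₗ M ∘ₗ U.symm.toLinearEquiv.toLinearMap

/-- `M` influences `N` through the channel of `U`: the commutator `[U† N U, M]` is nonzero. -/
def Influences (U : S ≃ₗᵢ[ℂ] T) (M : Module.End ℂ S) (N : Module.End ℂ T) : Prop :=
  channel U.symm N * M - M * channel U.symm N ≠ 0

/-- `M` influences the output system `G` (the right output factor) through the channel of `U`. -/
def InfluencesSystem (U : S ≃ₗᵢ[ℂ] T ⊗[ℂ] G) (M : Module.End ℂ S) : Prop :=
  ∃ N : Module.End ℂ G, Influences U M (onRight T N)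

/-- The operators on `S` made accessible to `G` by `U : S F → T G`: every generator on `S`
that does not commute with `M` influences `G`. -/
def accessible (U : S ⊗[ℂ] F ≃ₗᵢ[ℂ] T ⊗[ℂ] G) : Set (Module.End ℂ S) :=
  {M | ∀ K : Module.End ℂ S, M * K - K * M ≠ 0 → InfluencesSystem U (onLeft F K)}

/-- The interaction `U : S F → T G` followed by `V : T H → R I`, regarded as a bipartite
interaction from the system `S F` and the fragment `H` to the system `R G` and the
fragment `I`. -/
def followedBy (U : S ⊗[ℂ] F ≃ₗᵢ[ℂ] T ⊗[ℂ] G) (V : T ⊗[ℂ] H ≃ₗᵢ[ℂ] R ⊗[ℂ] I) :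
    (S ⊗[ℂ] F) ⊗[ℂ] H ≃ₗᵢ[ℂ] (R ⊗[ℂ] G) ⊗[ℂ] I :=
  (U.rTensor H).trans <|
  ((TensorProduct.commIsometry ℂ T G).rTensor H).trans <|
  (TensorProduct.assocIsometry ℂ G T H).trans <|
  (V.lTensor G).trans <|
  (TensorProduct.assocIsometry ℂ G R I).symm.trans <|
  (TensorProduct.commIsometry ℂ G R).rTensor I

/-- The operators on `S` left potentially accessible by `G` after `U : S F → T G`: there are a
further fragment with input `H` and output `I`, an output system `R`, and a unitary interaction
`V : T H → R I`, such that the operator is accessible to `I` after `U` followed by `V`.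
Every finite-dimensional Hilbert space being isometric to some `ℂⁿ`, it is enough to let
`H`, `R` and `I` range over the spaces `ℂⁿ`. -/
def potentiallyAccessible (U : S ⊗[ℂ] F ≃ₗᵢ[ℂ] T ⊗[ℂ] G) : Set (Module.End ℂ S) :=
  {M | ∃ (h r i : ℕ)
    (V : T ⊗[ℂ] EuclideanSpace ℂ (Fin h) ≃ₗᵢ[ℂ]
      EuclideanSpace ℂ (Fin r) ⊗[ℂ] EuclideanSpace ℂ (Fin i)),
    onLeft F M ∈ accessible (followedBy U V)}

end Discrete

section Unitary

variable {E : Type*} [NormedAddCommGroup E] [InnerProductSpace ℂ E] [FiniteDimensional ℂ E]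

/-- The operator `e^{-iHt}`. -/
def expOp (H : Module.End ℂ E) (t : ℝ) : E →L[ℂ] E :=
  NormedSpace.exp ((-(Complex.I * (t : ℂ))) • LinearMap.toContinuousLinearMap H)

theorem expOp_mem_unitary [CompleteSpace E] {H : Module.End ℂ E} (hH : H.IsSymmetric) (t : ℝ) :
    expOp H t ∈ unitary (E →L[ℂ] E) := by
  let _ : NormedAlgebra ℚ (E →L[ℂ] E) := NormedAlgebra.restrictScalars ℚ ℂ (E →L[ℂ] E)
  apply NormedSpace.exp_mem_unitary_of_mem_skewAdjoint
  have hs : star (LinearMap.toContinuousLinearMap H) = LinearMap.toContinuousLinearMap H := by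
    rw [ContinuousLinearMap.star_eq_adjoint]
    refine ((ContinuousLinearMap.eq_adjoint_iff _ _).2 fun x y => ?_).symm
    exact hH x y
  rw [skewAdjoint.mem_iff, star_smul, hs]
  simp

/-- The unitary time evolution map `e^{-iHt}` generated by a Hermitian operator `H`. -/
def evolution (H : Module.End ℂ E) (hH : H.IsSymmetric) (t : ℝ) : E ≃ₗᵢ[ℂ] E :=
  haveI : CompleteSpace E := FiniteDimensional.complete ℂ E
  Unitary.linearIsometryEquiv ⟨expOp H t, expOp_mem_unitary hH t⟩

theorem evolution_apply (H : Module.End ℂ E) (hH : H.IsSymmetric) (t : ℝ) (x : E) :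
    evolution H hH t x = expOp H t x := rfl

end Unitary

section Hamiltonian

variable {S F : Type*}
  [NormedAddCommGroup S] [InnerProductSpace ℂ S] [FiniteDimensional ℂ S]
  [NormedAddCommGroup F] [InnerProductSpace ℂ F] [FiniteDimensional ℂ F]

/-- The operators on `S` left potentially accessible by the Hamiltonian `H`: those left
potentially accessible at every time. -/
def hamPotentiallyAccessible (H : Module.End ℂ (S ⊗[ℂ] F)) (hH : H.IsSymmetric) :
    Set (Module.End ℂ S) :=
  ⋂ t : ℝ, potentiallyAccessible (evolution H hH t)

/-- The operators on `S` made accessible by `H`: the commutant, within the operators on `S`, of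
the potentially accessible operators. -/
def hamAccessible (H : Module.End ℂ (S ⊗[ℂ] F)) (hH : H.IsSymmetric) :
    Set (Module.End ℂ S) :=
  Set.centralizer (hamPotentiallyAccessible H hH)

/-- The operators on `S` decohered by `H`. -/
def hamDecohered (H : Module.End ℂ (S ⊗[ℂ] F)) (hH : H.IsSymmetric) :
    Set (Module.End ℂ S) :=
  hamAccessible H hH ∩ hamPotentiallyAccessible H hH

/-- The robust operators on `S`: those that commute with `H`. -/
def hamRobust (H : Module.End ℂ (S ⊗[ℂ] F)) : Set (Module.End ℂ S) :=
  {M | Commute (onLeft F M) H}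

/-- A nondegenerate observable: a Hermitian operator without repeated eigenvalues. -/
def IsNondegenerateObservable (M : Module.End ℂ S) : Prop :=
  M.IsSymmetric ∧ ∀ μ : ℂ, Module.finrank ℂ (Module.End.eigenspace M μ) ≤ 1

/-- `H` is maximally decohering: it decoheres some nondegenerate observable. -/
def MaximallyDecohering (H : Module.End ℂ (S ⊗[ℂ] F)) (hH : H.IsSymmetric) : Prop :=
  ∃ M ∈ hamDecohered H hH, IsNondegenerateObservable M

/-- `H = ∑ₖ |ψₖ⟩⟨ψₖ| ⊗ Kₖ` with Hermitian operators `Kₖ` on `F`. -/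
def IsControlForm {ι : Type*} [Fintype ι] (H : Module.End ℂ (S ⊗[ℂ] F))
    (ψ : OrthonormalBasis ι ℂ S) (K : ι → Module.End ℂ F) : Prop :=
  (∀ k, (K k).IsSymmetric) ∧
  H = ∑ k, TensorProduct.map (InnerProductSpace.rankOne ℂ (ψ k) (ψ k)).toLinearMap (K k)

end Hamiltonian

end

end Decoherence

/-!
An operator `M` on `S` is left potentially accessible after a unitary `U : S F → T G` if and only
if `U (M ⊗ 1) U†` commutes with all operators on `G` (`mem_potentiallyAccessible_iff`): operators
that `U` carries to `G` cannot influence what is later extracted from `T`, and conversely one may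
extract all of `T`. For a Hamiltonian `H`, the potentially accessible operators are thus those
which the evolution `𝒰ₜ` keeps on `S`, that is `𝒰ₜ (M ⊗ 1) = Mₜ ⊗ 1` for all `t`. They contain the
robust operators and are closed under adjoints, and `Mₜ` is again potentially accessible.

A decohered `M` is accessible, so it commutes with all `Mₜ`, and differentiating at `t = 0` gives
`[M ⊗ 1, [H, M ⊗ 1]] = 0`. For Hermitian `M` this forces `[H, M ⊗ 1] = 0`, because `[M ⊗ 1, ·]` is
diagonalizable (`commute_of_commute_commutator`); the general case follows by taking Hermitian and
anti-Hermitian parts. Hence decohered operators are robust.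

If `H` decoheres a nondegenerate observable, then `H` commutes with it and is block diagonal in its
eigenbasis `ψ`, with blocks `K k`. The matrix unit `|ψ k⟩⟨ψ l|` is potentially accessible when
`K k - K l` is a scalar `c`, since it then evolves by the phase `e^{-ict}`; it does not commute
with the observable, so no such difference is scalar. Conversely, the `(k, l)` block of the
commutator `[H, N ⊗ 1]` is a multiple of `K k - K l` and, for `N` potentially accessible, central,
so if `K k - K l` is not scalar the matrix element of `N` vanishes
(`IsControlForm.inner_eq_zero`). Finally, the projections on the elements of any control basis are
robust, so a decohered nondegenerate observable is diagonal in any two control bases, which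
therefore agree up to phases and ordering.
-/

namespace Decoherence

noncomputable section

/-! ### Channels and interactions -/

section Discrete

variable {S F T G H R I : Type*}
  [NormedAddCommGroup S] [InnerProductSpace ℂ S]
  [NormedAddCommGroup F] [InnerProductSpace ℂ F]
  [NormedAddCommGroup T] [InnerProductSpace ℂ T]
  [NormedAddCommGroup G] [InnerProductSpace ℂ G]
  [NormedAddCommGroup H] [InnerProductSpace ℂ H]
  [NormedAddCommGroup R] [InnerProductSpace ℂ R]
  [NormedAddCommGroup I] [InnerProductSpace ℂ I]

@[simp]
theorem onLeft_tmul (M : Module.End ℂ S) (s : S) (f : F) :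
    onLeft F M (s ⊗ₜ[ℂ] f) = M s ⊗ₜ[ℂ] f := rfl

@[simp]
theorem onRight_tmul (N : Module.End ℂ F) (s : S) (f : F) :
    onRight S N (s ⊗ₜ[ℂ] f) = s ⊗ₜ[ℂ] N f := rfl

theorem onLeft_mul (M N : Module.End ℂ S) : onLeft F (M * N) = onLeft F M * onLeft F N := by
  ext; simp

theorem onLeft_add (M N : Module.End ℂ S) : onLeft F (M + N) = onLeft F M + onLeft F N :=
  TensorProduct.map_add_left _ _ _

theorem onLeft_smul (c : ℂ) (M : Module.End ℂ S) : onLeft F (c • M) = c • onLeft F M :=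
  TensorProduct.map_smul_left _ _ _

theorem commute_onLeft_onRight (M : Module.End ℂ S) (N : Module.End ℂ F) :
    Commute (onLeft F M) (onRight S N) := by
  rw [commute_iff_eq]
  ext; simp

theorem subsingleton_tensor_right [Subsingleton F] : Subsingleton (S ⊗[ℂ] F) := by
  refine subsingleton_of_forall_eq 0 fun z => ?_
  induction z with
  | zero => rfl
  | tmul a b => rw [Subsingleton.elim b 0, TensorProduct.tmul_zero]
  | add a b ha hb => rw [ha, hb, add_zero]

theorem onLeft_injective [Nontrivial F] : Function.Injective (onLeft F (S := S)) := by
  intro M N h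
  ext s
  obtain ⟨f, hf⟩ := exists_ne (0 : F)
  have h1 : (M s - N s) ⊗ₜ[ℂ] f = 0 := by
    have := LinearMap.congr_fun h (s ⊗ₜ[ℂ] f)
    simp only [onLeft_tmul] at this
    rw [TensorProduct.sub_tmul, this, sub_self]
  have h2 : ‖M s - N s‖ * ‖f‖ = 0 := by rw [← TensorProduct.norm_tmul (𝕜 := ℂ), h1, norm_zero]
  rcases mul_eq_zero.1 h2 with h3 | h3
  · exact sub_eq_zero.1 (norm_eq_zero.1 h3)
  · exact absurd (norm_eq_zero.1 h3) hf

theorem commute_of_commute_onLeft [Nontrivial F] {M N : Module.End ℂ S}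
    (h : Commute (onLeft F M) (onLeft F N)) : Commute M N :=
  onLeft_injective (F := F) (by rw [onLeft_mul, onLeft_mul]; exact h)

theorem channel_apply (U : S ≃ₗᵢ[ℂ] T) (M : Module.End ℂ S) (x : T) :
    channel U M x = U (M (U.symm x)) := rfl

theorem channel_eq_iff {U : S ≃ₗᵢ[ℂ] T} {M : Module.End ℂ S} {N : Module.End ℂ T} :
    channel U M = N ↔ ∀ x, U (M x) = N (U x) := by
  constructor
  · rintro rfl x
    simp [channel_apply]
  · intro h
    ext x
    simp [channel_apply, h]

theorem channel_mul (U : S ≃ₗᵢ[ℂ] T) (M N : Module.End ℂ S) :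
    channel U (M * N) = channel U M * channel U N := by
  ext x; simp [channel_apply]

theorem channel_symm_channel (U : S ≃ₗᵢ[ℂ] T) (M : Module.End ℂ S) :
    channel U.symm (channel U M) = M := by
  ext x; simp [channel_apply]

theorem channel_channel_symm (U : S ≃ₗᵢ[ℂ] T) (M : Module.End ℂ T) :
    channel U (channel U.symm M) = M := by
  ext x; simp [channel_apply]

theorem commute_channel {M N : Module.End ℂ S} (h : Commute M N) (U : S ≃ₗᵢ[ℂ] T) :
    Commute (channel U M) (channel U N) := by
  rw [commute_iff_eq, ← channel_mul, h.eq, channel_mul]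

theorem commute_channel_iff {U : S ≃ₗᵢ[ℂ] T} {M : Module.End ℂ S} {N : Module.End ℂ T} :
    Commute (channel U M) N ↔ Commute M (channel U.symm N) := by
  constructor <;> intro h
  · simpa only [channel_symm_channel] using commute_channel h U.symm
  · simpa only [channel_channel_symm] using commute_channel h U

theorem rTensor_onLeft {U : S ≃ₗᵢ[ℂ] T} {A : Module.End ℂ S} {B : Module.End ℂ T}
    (h : ∀ x, U (A x) = B (U x)) (z : S ⊗[ℂ] H) :
    U.rTensor H (onLeft H A z) = onLeft H B (U.rTensor H z) := by
  induction z with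
  | zero => simp
  | tmul x y => simp [h]
  | add x y hx hy => simp only [map_add, hx, hy]

theorem lTensor_onRight {U : S ≃ₗᵢ[ℂ] T} {A : Module.End ℂ S} {B : Module.End ℂ T}
    (h : ∀ x, U (A x) = B (U x)) (z : H ⊗[ℂ] S) :
    U.lTensor H (onRight H A z) = onRight H B (U.lTensor H z) := by
  induction z with
  | zero => simp
  | tmul x y => simp [h]
  | add x y hx hy => simp only [map_add, hx, hy]

theorem lTensor_onLeft (U : S ≃ₗᵢ[ℂ] T) (A : Module.End ℂ H) (z : H ⊗[ℂ] S) :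
    U.lTensor H (onLeft S A z) = onLeft T A (U.lTensor H z) := by
  induction z with
  | zero => simp
  | tmul x y => simp
  | add x y hx hy => simp only [map_add, hx, hy]

theorem commIsometry_onLeft (A : Module.End ℂ S) (z : S ⊗[ℂ] T) :
    TensorProduct.commIsometry ℂ S T (onLeft T A z) =
      onRight T A (TensorProduct.commIsometry ℂ S T z) := by
  induction z with
  | zero => simp
  | tmul x y => simp
  | add x y hx hy => simp only [map_add, hx, hy]

theorem commIsometry_onRight (A : Module.End ℂ T) (z : S ⊗[ℂ] T) :
    TensorProduct.commIsometry ℂ S T (onRight S A z) =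
      onLeft S A (TensorProduct.commIsometry ℂ S T z) := by
  induction z with
  | zero => simp
  | tmul x y => simp
  | add x y hx hy => simp only [map_add, hx, hy]

/-- If `U` carries `A` to `Y ⊗ 1` and `V` carries `Y ⊗ 1` to `1 ⊗ N`, then `U` followed by `V`
carries `A` to the operator `N` on the output fragment. -/
theorem channel_followedBy_of_left {U : S ⊗[ℂ] F ≃ₗᵢ[ℂ] T ⊗[ℂ] G}
    {V : T ⊗[ℂ] H ≃ₗᵢ[ℂ] R ⊗[ℂ] I} {A : Module.End ℂ (S ⊗[ℂ] F)} {Y : Module.End ℂ T}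
    {N : Module.End ℂ I} (hU : channel U A = onLeft G Y)
    (hV : channel V (onLeft H Y) = onRight R N) :
    channel (followedBy U V) (onLeft H A) = onRight (R ⊗[ℂ] G) N := by
  have hassoc (z : (G ⊗[ℂ] T) ⊗[ℂ] H) :
      TensorProduct.assocIsometry ℂ G T H (onLeft H (onRight G Y) z) =
        onRight G (onLeft H Y) (TensorProduct.assocIsometry ℂ G T H z) := by
    rw [TensorProduct.assocIsometry_apply, TensorProduct.assocIsometry_apply]
    refine LinearMap.congr_fun (f := (TensorProduct.assoc ℂ G T H).toLinearMap ∘ₗ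
      onLeft H (onRight G Y)) (g := onRight G (onLeft H Y) ∘ₗ
      (TensorProduct.assoc ℂ G T H).toLinearMap) ?_ z
    ext; simp
  have hassoc' (z : G ⊗[ℂ] (R ⊗[ℂ] I)) :
      (TensorProduct.assocIsometry ℂ G R I).symm (onRight G (onRight R N) z) =
        onRight (G ⊗[ℂ] R) N ((TensorProduct.assocIsometry ℂ G R I).symm z) := by
    rw [TensorProduct.assocIsometry_symm_apply, TensorProduct.assocIsometry_symm_apply]
    refine LinearMap.congr_fun (f := (TensorProduct.assoc ℂ G R I).symm.toLinearMap ∘ₗ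
      onRight G (onRight R N)) (g := onRight (G ⊗[ℂ] R) N ∘ₗ
      (TensorProduct.assoc ℂ G R I).symm.toLinearMap) ?_ z
    ext; simp
  have hright (z : (G ⊗[ℂ] R) ⊗[ℂ] I) :
      (TensorProduct.commIsometry ℂ G R).rTensor I (onRight (G ⊗[ℂ] R) N z) =
        onRight (R ⊗[ℂ] G) N ((TensorProduct.commIsometry ℂ G R).rTensor I z) := by
    induction z with
    | zero => simp
    | tmul x y => simp
    | add x y hx hy => simp only [map_add, hx, hy]
  rw [channel_eq_iff] at hU hV ⊢
  intro z
  simp only [followedBy, LinearIsometryEquiv.trans_apply]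
  rw [rTensor_onLeft hU, rTensor_onLeft (commIsometry_onLeft Y), hassoc,
    lTensor_onRight hV, hassoc', hright]

/-- If `U` carries `A` to an operator on `G`, then so does `U` followed by `V`, since `V` does
not act on `G`. -/
theorem channel_followedBy_of_right {U : S ⊗[ℂ] F ≃ₗᵢ[ℂ] T ⊗[ℂ] G}
    (V : T ⊗[ℂ] H ≃ₗᵢ[ℂ] R ⊗[ℂ] I) {A : Module.End ℂ (S ⊗[ℂ] F)} {N : Module.End ℂ G}
    (hU : channel U A = onRight T N) :
    channel (followedBy U V) (onLeft H A) = onLeft I (onRight R N) := by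
  have hassoc (z : (G ⊗[ℂ] T) ⊗[ℂ] H) :
      TensorProduct.assocIsometry ℂ G T H (onLeft H (onLeft T N) z) =
        onLeft (T ⊗[ℂ] H) N (TensorProduct.assocIsometry ℂ G T H z) := by
    rw [TensorProduct.assocIsometry_apply, TensorProduct.assocIsometry_apply]
    refine LinearMap.congr_fun (f := (TensorProduct.assoc ℂ G T H).toLinearMap ∘ₗ
      onLeft H (onLeft T N)) (g := onLeft (T ⊗[ℂ] H) N ∘ₗ
      (TensorProduct.assoc ℂ G T H).toLinearMap) ?_ z
    ext; simp
  have hassoc' (z : G ⊗[ℂ] (R ⊗[ℂ] I)) :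
      (TensorProduct.assocIsometry ℂ G R I).symm (onLeft (R ⊗[ℂ] I) N z) =
        onLeft I (onLeft R N) ((TensorProduct.assocIsometry ℂ G R I).symm z) := by
    rw [TensorProduct.assocIsometry_symm_apply, TensorProduct.assocIsometry_symm_apply]
    refine LinearMap.congr_fun (f := (TensorProduct.assoc ℂ G R I).symm.toLinearMap ∘ₗ
      onLeft (R ⊗[ℂ] I) N) (g := onLeft I (onLeft R N) ∘ₗ
      (TensorProduct.assoc ℂ G R I).symm.toLinearMap) ?_ z
    ext; simp
  rw [channel_eq_iff] at hU ⊢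
  intro z
  simp only [followedBy, LinearIsometryEquiv.trans_apply]
  rw [rTensor_onLeft hU, rTensor_onLeft (commIsometry_onRight N), hassoc,
    lTensor_onLeft, hassoc', rTensor_onLeft (commIsometry_onLeft N)]

/-! ### Potentially accessible operators -/

/-- The commutant of the operators on the right factor consists of operators on the left
factor. -/
theorem exists_eq_onLeft [Nontrivial G] {X : Module.End ℂ (T ⊗[ℂ] G)}
    (h : ∀ N : Module.End ℂ G, Commute X (onRight T N)) : ∃ Y : Module.End ℂ T, X = onLeft G Y := by
  obtain ⟨g₀, hg₀⟩ := exists_ne (0 : G)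
  have hn : inner ℂ g₀ g₀ ≠ 0 := inner_self_ne_zero.2 hg₀
  -- `c` contracts the right factor with `g₀`, normalised so that `c (t ⊗ g₀) = t`.
  let c : T ⊗[ℂ] G →ₗ[ℂ] T :=
    (TensorProduct.rid ℂ T).toLinearMap ∘ₗ
      TensorProduct.map LinearMap.id ((inner ℂ g₀ g₀)⁻¹ • innerₛₗ ℂ g₀)
  let N (g : G) : Module.End ℂ G := ((inner ℂ g₀ g₀)⁻¹ • innerₛₗ ℂ g₀).smulRight g
  have hN (g : G) (z : T ⊗[ℂ] G) : onRight T (N g) z = c z ⊗ₜ[ℂ] g := by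
    induction z with
    | zero => simp
    | tmul x y => simp [N, c, TensorProduct.smul_tmul]
    | add x y hx hy => simp only [map_add, hx, hy, TensorProduct.add_tmul]
  have hc (t : T) : c (t ⊗ₜ[ℂ] g₀) = t := by
    simp [c, inv_mul_cancel₀ hn, -inner_self_eq_norm_sq_to_K]
  refine ⟨c ∘ₗ X ∘ₗ (TensorProduct.mk ℂ T G).flip g₀, ?_⟩
  ext t g
  have := LinearMap.congr_fun (h (N g)).eq (t ⊗ₜ[ℂ] g₀)
  simp only [Module.End.mul_apply, hN, hc] at this
  simpa using this

/-- An operator on `S` is left potentially accessible after `U` exactly if `U` carries it into the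
commutant of the operators on `G`. Necessity: the operators that `U` carries to `G` do not
influence any fragment produced from `T`. Sufficiency: let `V` turn all of `T` into the new
fragment. -/
theorem mem_potentiallyAccessible_iff [FiniteDimensional ℂ T]
    {U : S ⊗[ℂ] F ≃ₗᵢ[ℂ] T ⊗[ℂ] G} {M : Module.End ℂ S} :
    M ∈ potentiallyAccessible U ↔
      ∀ N : Module.End ℂ G, Commute (channel U (onLeft F M)) (onRight T N) := by
  constructor
  · rintro ⟨h, r, i, V, hV⟩ N
    rw [commute_channel_iff]
    by_contra hM
    obtain ⟨N', hN'⟩ := hV (channel U.symm (onRight T N)) (fun h0 => hM (sub_eq_zero.1 h0))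
    refine hN' (sub_eq_zero.2 ?_)
    have hK := channel_followedBy_of_right V (channel_channel_symm U (onRight T N))
    exact (commute_channel_iff.1 (hK ▸ commute_onLeft_onRight _ _)).symm
  · intro hM
    -- If `G = 0`, all operators on `S ⊗ F` vanish, and any `V` will do.
    rcases subsingleton_or_nontrivial G with hG | hG
    · refine ⟨1, 1, Module.finrank ℂ T, (TensorProduct.commIsometry ℂ T _).trans
        ((stdOrthonormalBasis ℂ T).repr.lTensor _), fun K hK => ?_⟩
      have : Subsingleton (T ⊗[ℂ] G) := subsingleton_tensor_right
      have : Subsingleton (S ⊗[ℂ] F) := U.toEquiv.subsingleton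
      exact absurd (Subsingleton.elim _ _) hK
    · obtain ⟨Y, hY⟩ := exists_eq_onLeft hM
      let e := (stdOrthonormalBasis ℂ T).repr
      obtain ⟨V, hV⟩ : ∃ V : T ⊗[ℂ] EuclideanSpace ℂ (Fin 1) ≃ₗᵢ[ℂ]
          EuclideanSpace ℂ (Fin 1) ⊗[ℂ] EuclideanSpace ℂ (Fin (Module.finrank ℂ T)),
          channel V (onLeft _ Y) = onRight _ (channel e Y) := by
        have heY (x : T) : e (Y x) = channel e Y (e x) := by simp [channel_apply]
        refine ⟨(TensorProduct.commIsometry ℂ T _).trans (e.lTensor _), channel_eq_iff.2 fun z => ?_⟩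
        rw [LinearIsometryEquiv.trans_apply, LinearIsometryEquiv.trans_apply,
          commIsometry_onLeft, lTensor_onRight heY]
      refine ⟨1, 1, Module.finrank ℂ T, V, fun K hK => ⟨channel e Y, fun h0 => hK ?_⟩⟩
      have hW : channel (followedBy U V).symm (onRight _ (channel e Y)) = onLeft _ (onLeft F M) := by
        rw [← channel_followedBy_of_left hY hV, channel_symm_channel]
      rw [hW] at h0
      exact sub_eq_zero.2 (commute_of_commute_onLeft (sub_eq_zero.1 h0)).eq

end Discrete
/-! ### Time evolution -/

section Unitary

variable {E : Type*} [NormedAddCommGroup E] [InnerProductSpace ℂ E] [FiniteDimensional ℂ E]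

theorem expOp_add (H : Module.End ℂ E) (s t : ℝ) : expOp H (s + t) = expOp H s * expOp H t := by
  have : CompleteSpace E := FiniteDimensional.complete ℂ E
  let _ : NormedAlgebra ℚ (E →L[ℂ] E) := NormedAlgebra.restrictScalars ℚ ℂ (E →L[ℂ] E)
  unfold expOp
  rw [← NormedSpace.exp_add_of_commute, ← add_smul]
  · congr 2
    push_cast
    ring
  · exact ((Commute.refl _).smul_left _).smul_right _

theorem expOp_mul_expOp_neg (H : Module.End ℂ E) (t : ℝ) : expOp H t * expOp H (-t) = 1 := by
  rw [← expOp_add, add_neg_cancel]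
  simp [expOp, NormedSpace.exp_zero]

theorem evolution_symm_apply (H : Module.End ℂ E) (hH : H.IsSymmetric) (t : ℝ) (x : E) :
    (evolution H hH t).symm x = expOp H (-t) x := by
  rw [LinearIsometryEquiv.symm_apply_eq, evolution_apply]
  exact (DFunLike.congr_fun (expOp_mul_expOp_neg H t) x).symm

theorem channel_evolution (H : Module.End ℂ E) (hH : H.IsSymmetric) (t : ℝ)
    (X : Module.End ℂ E) :
    channel (evolution H hH t) X =
      (expOp H t * LinearMap.toContinuousLinearMap X * expOp H (-t)).toLinearMap := by
  ext x
  simp [channel_apply, evolution_symm_apply, evolution_apply]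

/-- The infinitesimal form of invariance: a linear function of `𝒰ₜ X` that is constant in `t`
vanishes at the commutator `[H, X]`. -/
theorem map_commutator_eq_zero {H : Module.End ℂ E} {hH : H.IsSymmetric} {X : Module.End ℂ E}
    (L : Module.End ℂ E →ₗ[ℂ] Module.End ℂ E)
    (hL : ∀ t : ℝ, L (channel (evolution H hH t) X) = L X) : L (H * X - X * H) = 0 := by
  have : CompleteSpace E := FiniteDimensional.complete ℂ E
  let e : Module.End ℂ E ≃ₗ[ℂ] (E →L[ℂ] E) := LinearMap.toContinuousLinearMap
  let L' : (E →L[ℂ] E) →L[ℂ] (E →L[ℂ] E) :=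
    LinearMap.toContinuousLinearMap (e.toLinearMap ∘ₗ L ∘ₗ e.symm.toLinearMap)
  -- Differentiate `exp (z a) X exp (-z a)`, whose value at real `z = t` is `𝒰ₜ X`.
  let a : E →L[ℂ] E := (-Complex.I) • e H
  have h1 : HasDerivAt (fun z : ℂ => NormedSpace.exp (z • a)) a 0 := by
    simpa using hasDerivAt_exp_smul_const (𝕂 := ℂ) a (0 : ℂ)
  have h2 : HasDerivAt (fun z : ℂ => NormedSpace.exp ((-z) • a)) (-a) 0 := by
    simpa using hasDerivAt_exp_smul_const (𝕂 := ℂ) (-a) (0 : ℂ)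
  have h3 : HasDerivAt (fun z : ℂ =>
      NormedSpace.exp (z • a) * e X * NormedSpace.exp ((-z) • a)) (a * e X - e X * a) 0 := by
    refine ((h1.mul_const (e X)).mul h2).congr_deriv ?_
    simp [sub_eq_add_neg, NormedSpace.exp_zero]
  have h4 : HasDerivAt (fun t : ℝ => L' (NormedSpace.exp ((t : ℂ) • a) * e X *
      NormedSpace.exp ((-(t : ℂ)) • a))) (L' (a * e X - e X * a)) 0 := by
    have h5 : HasDerivAt (fun z : ℂ => L' (NormedSpace.exp (z • a) * e X *
      NormedSpace.exp ((-z) • a))) (L' (a * e X - e X * a)) ((0 : ℝ) : ℂ) := by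
      rw [Complex.ofReal_zero]
      exact L'.hasFDerivAt.comp_hasDerivAt (0 : ℂ) h3
    refine (h5.scomp (0 : ℝ) Complex.ofRealCLM.hasDerivAt).congr_deriv ?_
    simp
  have h6 : (fun t : ℝ => L' (NormedSpace.exp ((t : ℂ) • a) * e X *
      NormedSpace.exp ((-(t : ℂ)) • a))) = fun _ => e (L X) := by
    funext t
    rw [← hL t, channel_evolution]
    simp only [L', expOp, a, e, LinearMap.coe_toContinuousLinearMap', LinearMap.comp_apply,
      LinearEquiv.coe_coe]
    congr 2
    ext x
    simp [smul_smul, mul_comm]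
  rw [h6] at h4
  have h7 : L' (a * e X - e X * a) = 0 := h4.unique (hasDerivAt_const _ _)
  have h8 : a * e X - e X * a = e ((-Complex.I) • (H * X - X * H)) := by
    ext x
    simp [a, e, smul_sub]
  rw [h8] at h7
  have h9 : e (L ((-Complex.I) • (H * X - X * H))) = 0 := by simpa [L'] using h7
  rw [LinearEquiv.map_eq_zero_iff, map_smul, smul_eq_zero] at h9
  exact h9.resolve_left (neg_ne_zero.2 Complex.I_ne_zero)

/-- The case of `map_commutator_eq_zero` for the linear function `Z ↦ Z Y - Y Z`. -/
theorem commute_commutator_of_forall_commute_channel {H : Module.End ℂ E} {hH : H.IsSymmetric}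
    {X Y : Module.End ℂ E} (h : ∀ t : ℝ, Commute (channel (evolution H hH t) X) Y)
    (h0 : Commute X Y) : Commute (H * X - X * H) Y := by
  have := map_commutator_eq_zero (hH := hH) (X := X)
    (LinearMap.mulRight ℂ Y - LinearMap.mulLeft ℂ Y) fun t => by
      simp [(h t).eq, h0.eq]
  exact sub_eq_zero.1 (by simpa using this)

/-- An eigenvector of the derivation `[H, ·]` evolves by a phase. -/
theorem channel_evolution_of_commutator {H : Module.End ℂ E} (hH : H.IsSymmetric)
    {X : Module.End ℂ E} {c : ℂ} (h : H * X - X * H = c • X) (t : ℝ) :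
    ∃ d : ℂ, channel (evolution H hH t) X = d • X := by
  have : CompleteSpace E := FiniteDimensional.complete ℂ E
  let _ : NormedAlgebra ℚ (E →L[ℂ] E) := NormedAlgebra.restrictScalars ℚ ℂ (E →L[ℂ] E)
  let e : Module.End ℂ E ≃ₐ[ℂ] (E →L[ℂ] E) := Module.End.toContinuousLinearMap E
  let z : ℂ := -(Complex.I * (t : ℂ))
  have hs : SemiconjBy (e X) (algebraMap ℂ _ (z * c) + z • e H) (z • e H) := by
    have h' : e H * e X = c • e X + e X * e H := by
      rw [← map_mul, ← map_mul, ← map_smul, ← map_add, ← h, sub_add_cancel]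
    rw [SemiconjBy, smul_mul_assoc, h', mul_add, Algebra.algebraMap_eq_smul_one]
    simp [smul_smul]
  have hexp := hs.exp_right
  rw [NormedSpace.exp_add_of_commute (Algebra.commutes _ _),
    ← NormedSpace.algebraMap_exp_comm] at hexp
  refine ⟨NormedSpace.exp (z * c), ?_⟩
  rw [channel_evolution]
  have h1 : expOp H t * e X = NormedSpace.exp (z * c) • (e X * expOp H t) := by
    refine hexp.eq.symm.trans ?_
    rw [Algebra.algebraMap_eq_smul_one, smul_mul_assoc, one_mul, mul_smul_comm]
    rfl
  have h2 : expOp H t * e X * expOp H (-t) = NormedSpace.exp (z * c) • e X := by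
    rw [h1, smul_mul_assoc, mul_assoc, expOp_mul_expOp_neg, mul_one]
  change (expOp H t * e X * expOp H (-t)).toLinearMap = _
  rw [h2]
  ext x
  rfl

theorem forall_channel_evolution_eq_iff {H : Module.End ℂ E} {hH : H.IsSymmetric}
    {X : Module.End ℂ E} :
    (∀ t : ℝ, channel (evolution H hH t) X = X) ↔ Commute X H := by
  constructor
  · intro h
    have := map_commutator_eq_zero (hH := hH) (X := X) LinearMap.id fun t => by simp [h]
    exact (sub_eq_zero.1 this).symm
  · intro h t
    have hexp : Commute (LinearMap.toContinuousLinearMap X) (expOp H t) := by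
      have : CompleteSpace E := FiniteDimensional.complete ℂ E
      refine Commute.exp_right (Commute.smul_right ?_ _)
      exact h.map (Module.End.toContinuousLinearMap E)
    rw [channel_evolution, ← hexp.eq, mul_assoc, expOp_mul_expOp_neg, mul_one]
    rfl

/-- For a Hermitian operator `A`, the map `[A, ·]` is diagonalizable with eigenvalues the
differences of eigenvalues of `A`, hence its square has the same kernel. -/
theorem commute_of_commute_commutator {A B : Module.End ℂ E} (hA : A.IsSymmetric)
    (h : Commute A (A * B - B * A)) : Commute A B := by
  set C := A * B - B * A
  let v := hA.eigenvectorBasis rfl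
  let a := hA.eigenvalues rfl
  have hv (j) : A (v j) = (a j : ℂ) • v j := hA.apply_eigenvectorBasis rfl j
  have key (X : Module.End ℂ E) (i j) :
      inner ℂ (v i) ((A * X - X * A) (v j)) = ((a i : ℂ) - a j) * inner ℂ (v i) (X (v j)) := by
    rw [LinearMap.sub_apply, Module.End.mul_apply, Module.End.mul_apply, inner_sub_right, ← hA,
      hv, hv, map_smul, inner_smul_left, inner_smul_right, Complex.conj_ofReal, sub_mul]
  suffices C = 0 from sub_eq_zero.1 this
  refine v.toBasis.ext fun j => InnerProductSpace.ext_inner_left_basis v.toBasis fun i => ?_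
  simp only [OrthonormalBasis.coe_toBasis, LinearMap.zero_apply, inner_zero_right]
  have h1 := key C i j
  rw [sub_eq_zero.2 h.eq, LinearMap.zero_apply, inner_zero_right] at h1
  rcases mul_eq_zero.1 h1.symm with h2 | h2
  · exact (key B i j).trans (by rw [h2, zero_mul])
  · exact h2

end Unitary

/-! ### Decohered operators are robust -/

section Hamiltonian

variable {S F : Type*}
  [NormedAddCommGroup S] [InnerProductSpace ℂ S] [FiniteDimensional ℂ S]
  [NormedAddCommGroup F] [InnerProductSpace ℂ F] [FiniteDimensional ℂ F]
  {H : Module.End ℂ (S ⊗[ℂ] F)} {hH : H.IsSymmetric}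

theorem mem_hamPotentiallyAccessible_iff {M : Module.End ℂ S} :
    M ∈ hamPotentiallyAccessible H hH ↔ ∀ (t : ℝ) (N : Module.End ℂ F),
      Commute (channel (evolution H hH t) (onLeft F M)) (onRight S N) := by
  simp only [hamPotentiallyAccessible, Set.mem_iInter, mem_potentiallyAccessible_iff]

theorem mem_hamRobust_iff {M : Module.End ℂ S} :
    M ∈ hamRobust H ↔ ∀ t : ℝ, channel (evolution H hH t) (onLeft F M) = onLeft F M :=
  forall_channel_evolution_eq_iff.symm

theorem mem_hamPotentiallyAccessible_of_commutator {M : Module.End ℂ S} {c : ℂ}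
    (h : H * onLeft F M - onLeft F M * H = c • onLeft F M) :
    M ∈ hamPotentiallyAccessible H hH := by
  rw [mem_hamPotentiallyAccessible_iff]
  intro t N
  obtain ⟨d, hd⟩ := channel_evolution_of_commutator hH h t
  rw [hd]
  exact (commute_onLeft_onRight M N).smul_left d

/-- Robust operators stay on `S` under the evolution, hence they are potentially accessible. -/
theorem hamRobust_subset : hamRobust H ⊆ hamPotentiallyAccessible H hH := fun M hM =>
  mem_hamPotentiallyAccessible_of_commutator (c := 0) <| by
    rw [zero_smul, sub_eq_zero]; exact hM.eq.symm

theorem adjoint_channel {E E' : Type*} [NormedAddCommGroup E] [InnerProductSpace ℂ E]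
    [FiniteDimensional ℂ E] [NormedAddCommGroup E'] [InnerProductSpace ℂ E']
    [FiniteDimensional ℂ E'] (U : E ≃ₗᵢ[ℂ] E') (M : Module.End ℂ E) :
    LinearMap.adjoint (channel U M) = channel U (LinearMap.adjoint M) := by
  refine ((LinearMap.eq_adjoint_iff _ _).2 fun x y => ?_).symm
  rw [channel_apply, channel_apply, LinearIsometryEquiv.inner_map_eq_flip,
    LinearMap.adjoint_inner_left]
  exact U.symm.inner_map_eq_flip x _

theorem adjoint_onLeft (M : Module.End ℂ S) :
    LinearMap.adjoint (onLeft F M) = onLeft F (LinearMap.adjoint M) := by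
  rw [onLeft, TensorProduct.adjoint_map, LinearMap.adjoint_id, onLeft]

theorem adjoint_onRight (N : Module.End ℂ F) :
    LinearMap.adjoint (onRight S N) = onRight S (LinearMap.adjoint N) := by
  rw [onRight, TensorProduct.adjoint_map, LinearMap.adjoint_id, onRight]

theorem commute_adjoint {E : Type*} [NormedAddCommGroup E] [InnerProductSpace ℂ E]
    [FiniteDimensional ℂ E] {M N : Module.End ℂ E} (h : Commute M N) :
    Commute (LinearMap.adjoint M) (LinearMap.adjoint N) :=
  Commute.star_star h

theorem adjoint_mem_hamPotentiallyAccessible {M : Module.End ℂ S}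
    (hM : M ∈ hamPotentiallyAccessible H hH) :
    LinearMap.adjoint M ∈ hamPotentiallyAccessible H hH := by
  rw [mem_hamPotentiallyAccessible_iff] at hM ⊢
  intro t N
  have := commute_adjoint (hM t (LinearMap.adjoint N))
  rwa [adjoint_channel, adjoint_onLeft, adjoint_onRight, LinearMap.adjoint_adjoint] at this

/-- The evolved operator `𝒰ₜ (M ⊗ 1)` is again of the form `Mₜ ⊗ 1` with `Mₜ` potentially
accessible. -/
theorem exists_channel_eq_onLeft [Nontrivial F] {M : Module.End ℂ S}
    (hM : M ∈ hamPotentiallyAccessible H hH) (t : ℝ) :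
    ∃ N ∈ hamPotentiallyAccessible H hH,
      channel (evolution H hH t) (onLeft F M) = onLeft F N := by
  rw [mem_hamPotentiallyAccessible_iff] at hM
  obtain ⟨N, hN⟩ := exists_eq_onLeft (hM t)
  refine ⟨N, mem_hamPotentiallyAccessible_iff.2 fun s K => ?_, hN⟩
  have hst : channel (evolution H hH s) (channel (evolution H hH t) (onLeft F M)) =
      channel (evolution H hH (s + t)) (onLeft F M) := by
    refine LinearMap.ext fun x => ?_
    simp only [channel_apply, evolution_apply, evolution_symm_apply]
    rw [neg_add_rev, expOp_add, expOp_add]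
    rfl
  rw [← hN, hst]
  exact hM _ K

/-- A Hermitian decohered operator `M` commutes with every `Mₜ` where `𝒰ₜ (M ⊗ 1) = Mₜ ⊗ 1`,
hence with the derivative `[H, M ⊗ 1]`. -/
theorem mem_hamRobust_of_isSymmetric [Nontrivial F] {M : Module.End ℂ S} (hs : M.IsSymmetric)
    (hM : M ∈ hamDecohered H hH) : M ∈ hamRobust H := by
  have hs' : (onLeft F M).IsSymmetric := by
    rw [LinearMap.isSymmetric_iff_isSelfAdjoint, LinearMap.isSelfAdjoint_iff'] at hs ⊢
    rw [adjoint_onLeft, hs]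
  refine commute_of_commute_commutator hs' ?_
  have h1 : Commute (H * onLeft F M - onLeft F M * H) (onLeft F M) := by
    refine commute_commutator_of_forall_commute_channel (hH := hH) (fun t => ?_) (Commute.refl _)
    obtain ⟨N, hN, hN'⟩ := exists_channel_eq_onLeft hM.2 t
    rw [hN', commute_iff_eq, ← onLeft_mul, (hM.1 N hN), onLeft_mul]
  rw [← neg_sub]
  exact h1.neg_left.symm

theorem add_mem_hamDecohered {M N : Module.End ℂ S} (hM : M ∈ hamDecohered H hH)
    (hN : N ∈ hamDecohered H hH) : M + N ∈ hamDecohered H hH := by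
  refine ⟨Set.add_mem_centralizer hM.1 hN.1, mem_hamPotentiallyAccessible_iff.2 fun t K => ?_⟩
  have h1 := mem_hamPotentiallyAccessible_iff.1 hM.2 t K
  have h2 := mem_hamPotentiallyAccessible_iff.1 hN.2 t K
  rw [commute_channel_iff] at h1 h2 ⊢
  rw [onLeft_add]
  exact h1.add_left h2

theorem smul_mem_hamDecohered (c : ℂ) {M : Module.End ℂ S} (hM : M ∈ hamDecohered H hH) :
    c • M ∈ hamDecohered H hH := by
  refine ⟨Set.smul_mem_centralizer c hM.1, mem_hamPotentiallyAccessible_iff.2 fun t K => ?_⟩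
  have h1 := mem_hamPotentiallyAccessible_iff.1 hM.2 t K
  rw [commute_channel_iff] at h1 ⊢
  rw [onLeft_smul]
  exact h1.smul_left c

/-- Both the potentially accessible and the accessible operators are closed under adjoints. -/
theorem adjoint_mem_hamDecohered {M : Module.End ℂ S} (hM : M ∈ hamDecohered H hH) :
    LinearMap.adjoint M ∈ hamDecohered H hH := by
  refine ⟨fun N hN => ?_, adjoint_mem_hamPotentiallyAccessible hM.2⟩
  have := commute_adjoint (hM.1 _ (adjoint_mem_hamPotentiallyAccessible hN))
  rwa [LinearMap.adjoint_adjoint] at this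

theorem hamDecohered_subset_hamRobust : hamDecohered H hH ⊆ hamRobust H := by
  intro M hM
  rcases subsingleton_or_nontrivial F with hF | hF
  · have : Subsingleton (S ⊗[ℂ] F) := subsingleton_tensor_right
    exact LinearMap.ext fun z => Subsingleton.elim _ _
  -- Decompose `2 M = A - i B` with `A` and `B` Hermitian.
  have hM' := adjoint_mem_hamDecohered hM
  have hA := mem_hamRobust_of_isSymmetric (M := M + LinearMap.adjoint M)
    (by rw [LinearMap.isSymmetric_iff_isSelfAdjoint, LinearMap.isSelfAdjoint_iff']
        simp [add_comm]) (add_mem_hamDecohered hM hM')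
  have hB := mem_hamRobust_of_isSymmetric
    (M := Complex.I • M + (-Complex.I) • LinearMap.adjoint M)
    (by rw [LinearMap.isSymmetric_iff_isSelfAdjoint, LinearMap.isSelfAdjoint_iff']
        simp only [map_add, map_smulₛₗ, LinearMap.adjoint_adjoint, map_neg, Complex.conj_I,
          neg_neg]
        abel)
    (add_mem_hamDecohered (smul_mem_hamDecohered _ hM) (smul_mem_hamDecohered _ hM'))
  have h2 : onLeft F M = (1 / 2 : ℂ) • (onLeft F (M + LinearMap.adjoint M) -
      Complex.I • onLeft F (Complex.I • M + (-Complex.I) • LinearMap.adjoint M)) := by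
    simp only [onLeft_add, onLeft_smul, smul_add, smul_smul, mul_neg, Complex.I_mul_I]
    module
  change Commute _ _
  rw [h2]
  exact (Commute.sub_left hA (Commute.smul_left hB _)).smul_left _

theorem hamDecohered_eq : hamDecohered H hH = hamAccessible H hH ∩ hamRobust H :=
  Set.Subset.antisymm (fun _ hM => ⟨hM.1, hamDecohered_subset_hamRobust hM⟩)
    fun _ hM => ⟨hM.1, hamRobust_subset hM.2⟩

end Hamiltonian

/-! ### Control Hamiltonians -/

section Control

variable {S F : Type*}
  [NormedAddCommGroup S] [InnerProductSpace ℂ S]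
  [NormedAddCommGroup F] [InnerProductSpace ℂ F]
  {ι : Type*} [Fintype ι]

/-- The contraction `⟨s| ⊗ 1` of the left factor with a vector. -/
def contractLeft (F : Type*) [NormedAddCommGroup F] [InnerProductSpace ℂ F] (s : S) :
    S ⊗[ℂ] F →ₗ[ℂ] F :=
  (TensorProduct.lid ℂ F).toLinearMap ∘ₗ TensorProduct.map (innerₛₗ ℂ s) LinearMap.id

@[simp]
theorem contractLeft_tmul (s s' : S) (f : F) :
    contractLeft F s (s' ⊗ₜ[ℂ] f) = inner ℂ s s' • f := by
  simp [contractLeft]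

theorem contractLeft_onRight (s : S) (N : Module.End ℂ F) (z : S ⊗[ℂ] F) :
    contractLeft F s (onRight S N z) = N (contractLeft F s z) := by
  induction z with
  | zero => simp
  | tmul x y => simp
  | add x y hx hy => simp only [map_add, hx, hy]

theorem tensor_ext_orthonormalBasis {W : Type*} [AddCommGroup W] [Module ℂ W]
    (ψ : OrthonormalBasis ι ℂ S) {f g : S ⊗[ℂ] F →ₗ[ℂ] W}
    (h : ∀ k x, f (ψ k ⊗ₜ[ℂ] x) = g (ψ k ⊗ₜ[ℂ] x)) : f = g := by
  refine TensorProduct.ext (ψ.toBasis.ext fun k => LinearMap.ext fun x => ?_)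
  simpa using h k x

theorem sum_tmul_contractLeft (ψ : OrthonormalBasis ι ℂ S) (z : S ⊗[ℂ] F) :
    ∑ k, ψ k ⊗ₜ[ℂ] contractLeft F (ψ k) z = z := by
  induction z with
  | zero => simp
  | tmul x y =>
    conv_rhs => rw [← ψ.sum_repr' x]
    simp [TensorProduct.sum_tmul, TensorProduct.smul_tmul]
  | add x y hx hy => simp only [map_add, TensorProduct.tmul_add, Finset.sum_add_distrib, hx, hy]

/-- A vector orthogonal to all but one element of an orthonormal basis is a multiple of that
element. -/
theorem eq_smul_of_inner_eq_zero (ψ : OrthonormalBasis ι ℂ S) {l : ι} {v : S}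
    (h : ∀ k, k ≠ l → inner ℂ (ψ k) v = 0) : v = inner ℂ (ψ l) v • ψ l := by
  conv_lhs => rw [← ψ.sum_repr' v]
  exact Finset.sum_eq_single l (fun k _ hk => by rw [h k hk, zero_smul]) (by simp)

theorem inner_eq_zero_of_eigenvalue_ne {M : Module.End ℂ S} (hM : M.IsSymmetric) {a b : ℂ}
    {v w : S} (hv : M v = a • v) (hw : M w = b • w) (hab : a ≠ b) : inner ℂ v w = 0 :=
  hM.orthogonalFamily_eigenspaces hab ⟨v, Module.End.mem_eigenspace_iff.2 hv⟩
    ⟨w, Module.End.mem_eigenspace_iff.2 hw⟩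

variable {H : Module.End ℂ (S ⊗[ℂ] F)} {ψ : OrthonormalBasis ι ℂ S} {K : ι → Module.End ℂ F}

theorem isControlForm_iff : IsControlForm H ψ K ↔
    (∀ k, (K k).IsSymmetric) ∧ ∀ k x, H (ψ k ⊗ₜ[ℂ] x) = ψ k ⊗ₜ[ℂ] K k x := by
  refine and_congr_right fun _ => ?_
  have hsum (k : ι) (x : F) : (∑ l, TensorProduct.map
      (InnerProductSpace.rankOne ℂ (ψ l) (ψ l)).toLinearMap (K l)) (ψ k ⊗ₜ[ℂ] x) =
      ψ k ⊗ₜ[ℂ] K k x := by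
    rw [LinearMap.sum_apply, Finset.sum_eq_single k]
    · simp
    · intro l _ hl
      simp [ψ.inner_eq_zero hl]
    · simp
  constructor
  · rintro rfl k x
    exact hsum k x
  · intro h
    exact tensor_ext_orthonormalBasis ψ fun k x => (h k x).trans (hsum k x).symm

theorem IsControlForm.apply (h : IsControlForm H ψ K) (k : ι) (x : F) :
    H (ψ k ⊗ₜ[ℂ] x) = ψ k ⊗ₜ[ℂ] K k x :=
  (isControlForm_iff.1 h).2 k x

theorem IsControlForm.contractLeft (h : IsControlForm H ψ K) (k : ι) (z : S ⊗[ℂ] F) :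
    contractLeft F (ψ k) (H z) = K k (contractLeft F (ψ k) z) := by
  refine LinearMap.congr_fun (f := Decoherence.contractLeft F (ψ k) ∘ₗ H)
    (g := K k ∘ₗ Decoherence.contractLeft F (ψ k))
    (tensor_ext_orthonormalBasis ψ fun l x => ?_) z
  rcases eq_or_ne k l with rfl | hkl
  · simp [h.apply]
  · simp [h.apply, ψ.inner_eq_zero hkl]

/-- An operator that commutes with the Hamiltonian and is diagonal with distinct eigenvalues in
the basis `ψ` forces the Hamiltonian into control form with control basis `ψ`. -/
theorem exists_isControlForm (hH : H.IsSymmetric) {M : Module.End ℂ S} {a : ι → ℂ}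
    (ha : Function.Injective a) (hM : ∀ k, M (ψ k) = a k • ψ k) (hR : M ∈ hamRobust H) :
    ∃ K, IsControlForm H ψ K := by
  classical
  have hc (k : ι) (z : S ⊗[ℂ] F) :
      contractLeft F (ψ k) (onLeft F M z) = a k • contractLeft F (ψ k) z := by
    refine LinearMap.congr_fun (f := contractLeft F (ψ k) ∘ₗ onLeft F M)
      (g := a k • contractLeft F (ψ k)) (tensor_ext_orthonormalBasis ψ fun l x => ?_) z
    rcases eq_or_ne k l with rfl | hkl
    · simp [hM]
    · simp [hM, ψ.inner_eq_zero hkl]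
  let K (k : ι) : Module.End ℂ F :=
    contractLeft F (ψ k) ∘ₗ H ∘ₗ TensorProduct.mk ℂ S F (ψ k)
  have hK (k : ι) (x : F) : H (ψ k ⊗ₜ[ℂ] x) = ψ k ⊗ₜ[ℂ] K k x := by
    rw [← sum_tmul_contractLeft ψ (H (ψ k ⊗ₜ[ℂ] x)), Finset.sum_eq_single k]
    · rfl
    · intro l _ hl
      have h1 : onLeft F M (H (ψ k ⊗ₜ[ℂ] x)) = a k • H (ψ k ⊗ₜ[ℂ] x) := by
        have := LinearMap.congr_fun hR.eq (ψ k ⊗ₜ[ℂ] x)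
        simpa [hM, ← TensorProduct.smul_tmul'] using this
      have h2 := hc l (H (ψ k ⊗ₜ[ℂ] x))
      rw [h1, map_smul, ← sub_eq_zero, ← sub_smul, smul_eq_zero, sub_eq_zero] at h2
      rw [h2.resolve_left fun h => hl (ha h).symm, TensorProduct.tmul_zero]
    · simp
  refine ⟨K, isControlForm_iff.2 ⟨fun k x y => ?_, hK⟩⟩
  have := hH (ψ k ⊗ₜ[ℂ] x) (ψ k ⊗ₜ[ℂ] y)
  simpa [hK] using this

/-- The projections on the elements of a control basis are robust. -/
theorem IsControlForm.rankOne_mem_hamRobust (h : IsControlForm H ψ K) (k : ι) :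
    (InnerProductSpace.rankOne ℂ (ψ k) (ψ k)).toLinearMap ∈ hamRobust H := by
  refine tensor_ext_orthonormalBasis ψ fun l x => ?_
  rcases eq_or_ne k l with rfl | hkl
  · simp [h.apply]
  · simp [h.apply, ψ.inner_eq_zero hkl]

variable [FiniteDimensional ℂ S] [FiniteDimensional ℂ F]

/-- If `K k - K l` is the scalar `c`, then the matrix unit `|ψ k⟩⟨ψ l|` evolves by a phase, hence
it is potentially accessible. -/
theorem IsControlForm.rankOne_mem_hamPotentiallyAccessible {hH : H.IsSymmetric}
    (h : IsControlForm H ψ K) {k l : ι} {c : ℂ} (hc : K k - K l = c • (1 : Module.End ℂ F)) :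
    (InnerProductSpace.rankOne ℂ (ψ k) (ψ l)).toLinearMap ∈ hamPotentiallyAccessible H hH := by
  refine mem_hamPotentiallyAccessible_of_commutator (c := c)
    (tensor_ext_orthonormalBasis ψ fun j x => ?_)
  rcases eq_or_ne l j with rfl | hlj
  · have hx : K k x - K l x = c • x := LinearMap.congr_fun hc x
    simp [h.apply, ← TensorProduct.tmul_sub, hx]
  · simp [h.apply, ψ.inner_eq_zero hlj]

/-- If `K k - K l` is not scalar, then potentially accessible operators have no matrix element
between `ψ k` and `ψ l`. -/
theorem IsControlForm.inner_eq_zero {hH : H.IsSymmetric} (h : IsControlForm H ψ K) {k l : ι}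
    (hkl : ¬ ∃ c : ℂ, K k - K l = c • (1 : Module.End ℂ F)) {N : Module.End ℂ S}
    (hN : N ∈ hamPotentiallyAccessible H hH) : inner ℂ (ψ k) (N (ψ l)) = 0 := by
  set n := inner ℂ (ψ k) (N (ψ l)) with hn
  by_contra hn0
  -- The `(k, l)` block of the commutator `[H, N ⊗ 1]` is `n (K k - K l)`.
  have hblock (x : F) : Decoherence.contractLeft F (ψ k)
      ((H * onLeft F N - onLeft F N * H) (ψ l ⊗ₜ[ℂ] x)) = n • (K k - K l) x := by
    simp [h.contractLeft, h.apply, smul_sub, hn]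
  have hcomm (X : Module.End ℂ F) : X * (n • (K k - K l)) = n • (K k - K l) * X := by
    have h1 := commute_commutator_of_forall_commute_channel
      (fun t => mem_hamPotentiallyAccessible_iff.1 hN t X) (commute_onLeft_onRight N X)
    ext x
    have h2 := LinearMap.congr_fun h1.eq (ψ l ⊗ₜ[ℂ] x)
    have h3 := congrArg (Decoherence.contractLeft F (ψ k)) h2
    rw [Module.End.mul_apply, Module.End.mul_apply, contractLeft_onRight, onRight_tmul, hblock,
      hblock] at h3
    exact h3.symm
  have hcen : n • (K k - K l) ∈ Subalgebra.center ℂ (Module.End ℂ F) :=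
    Subalgebra.mem_center_iff.2 hcomm
  rw [Algebra.IsCentral.center_eq_bot, Algebra.mem_bot] at hcen
  obtain ⟨c, hc⟩ := hcen
  refine hkl ⟨n⁻¹ * c, ?_⟩
  rw [mul_smul, ← Algebra.algebraMap_eq_smul_one, hc, inv_smul_smul₀ hn0]

/-! ### Nondegenerate observables -/

theorem IsNondegenerateObservable.exists_smul_eq {M : Module.End ℂ S}
    (hM : IsNondegenerateObservable M) {μ : ℂ} {v w : S} (hv : M v = μ • v) (hw : M w = μ • w)
    (hv0 : v ≠ 0) : ∃ c : ℂ, w = c • v := by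
  have hv' : v ∈ Module.End.eigenspace M μ := Module.End.mem_eigenspace_iff.2 hv
  have hw' : w ∈ Module.End.eigenspace M μ := Module.End.mem_eigenspace_iff.2 hw
  obtain ⟨u, hu⟩ := finrank_le_one_iff.1 (hM.2 μ)
  obtain ⟨a, ha⟩ := hu ⟨v, hv'⟩
  obtain ⟨b, hb⟩ := hu ⟨w, hw'⟩
  have ha' : a • (u : S) = v := congrArg Subtype.val ha
  have hb' : b • (u : S) = w := congrArg Subtype.val hb
  have ha0 : a ≠ 0 := by
    rintro rfl
    exact hv0 (by rw [← ha', zero_smul])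
  exact ⟨b * a⁻¹, by rw [← ha', smul_smul, inv_mul_cancel_right₀ ha0, hb']⟩

theorem IsNondegenerateObservable.eigenvalue_injective {M : Module.End ℂ S}
    (hM : IsNondegenerateObservable M) {a : ι → ℂ} (ha : ∀ k, M (ψ k) = a k • ψ k) :
    Function.Injective a := by
  intro k l hkl
  by_contra hne
  obtain ⟨c, hc⟩ := hM.exists_smul_eq (ha k) (hkl ▸ ha l) (ψ.orthonormal.ne_zero k)
  have h1 := ψ.inner_eq_zero hne
  rw [hc, inner_smul_right, OrthonormalBasis.inner_eq_one, mul_one] at h1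
  exact ψ.orthonormal.ne_zero l (by rw [hc, h1, zero_smul])

theorem exists_isNondegenerateObservable (ψ : OrthonormalBasis ι ℂ S) {a : ι → ℝ}
    (ha : Function.Injective a) :
    ∃ M : Module.End ℂ S, IsNondegenerateObservable M ∧ ∀ k, M (ψ k) = (a k : ℂ) • ψ k := by
  let M : Module.End ℂ S := ψ.toBasis.constr ℂ fun k => (a k : ℂ) • ψ k
  have hM (k : ι) : M (ψ k) = (a k : ℂ) • ψ k := by
    rw [← ψ.coe_toBasis]
    exact ψ.toBasis.constr_basis ℂ _ k
  have hs : M.IsSymmetric := by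
    rw [LinearMap.isSymmetric_iff_isSelfAdjoint, LinearMap.isSelfAdjoint_iff']
    refine ψ.toBasis.ext fun k => InnerProductSpace.ext_inner_left_basis ψ.toBasis fun l => ?_
    rw [LinearMap.adjoint_inner_right]
    rcases eq_or_ne l k with rfl | hlk
    · rw [ψ.coe_toBasis, hM, inner_smul_left, inner_smul_right, Complex.conj_ofReal]
    · rw [ψ.coe_toBasis, hM, hM, inner_smul_left, inner_smul_right, ψ.inner_eq_zero hlk, mul_zero,
        mul_zero]
  refine ⟨M, ⟨hs, fun μ => ?_⟩, hM⟩
  by_cases h : ∃ l, (a l : ℂ) = μ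
  · obtain ⟨l, rfl⟩ := h
    refine finrank_le_one (⟨ψ l, Module.End.mem_eigenspace_iff.2 (hM l)⟩ :
      Module.End.eigenspace M (a l : ℂ)) fun w => ⟨inner ℂ (ψ l) (w : S), Subtype.ext ?_⟩
    refine (eq_smul_of_inner_eq_zero ψ fun k hk => ?_).symm
    exact inner_eq_zero_of_eigenvalue_ne hs (hM k) (Module.End.mem_eigenspace_iff.1 w.2)
      fun h => hk (ha (Complex.ofReal_injective h))
  · refine finrank_le_one 0 fun w => ⟨0, Subtype.ext ?_⟩
    refine InnerProductSpace.ext_inner_left_basis ψ.toBasis fun k => ?_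
    have := inner_eq_zero_of_eigenvalue_ne hs (hM k) (Module.End.mem_eigenspace_iff.1 w.2)
      fun hk => h ⟨k, hk⟩
    simp [this]

/-- Orthonormal eigenbases of a nondegenerate observable agree up to phases and ordering. -/
theorem IsNondegenerateObservable.exists_perm {M : Module.End ℂ S}
    (hM : IsNondegenerateObservable M) {ψ' : OrthonormalBasis ι ℂ S} {a a' : ι → ℂ}
    (ha : ∀ k, M (ψ k) = a k • ψ k) (ha' : ∀ k, M (ψ' k) = a' k • ψ' k) :
    ∃ (σ : Equiv.Perm ι) (c : ι → ℂ), (∀ k, ‖c k‖ = 1) ∧ ∀ k, ψ' k = c k • ψ (σ k) := by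
  have key (k : ι) : ∃ (l : ι) (c : ℂ), ψ' k = c • ψ l := by
    obtain ⟨l, hl⟩ : ∃ l, inner ℂ (ψ l) (ψ' k) ≠ 0 := by
      by_contra! h
      refine ψ'.orthonormal.ne_zero k
        (InnerProductSpace.ext_inner_left_basis ψ.toBasis fun l => ?_)
      simp [h l]
    have hal : a l = a' k := by
      by_contra hne
      exact hl (inner_eq_zero_of_eigenvalue_ne hM.1 (ha l) (ha' k) hne)
    exact ⟨l, hM.exists_smul_eq (ha l) (hal ▸ ha' k) (ψ.orthonormal.ne_zero l)⟩
  choose σ c hc using key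
  have hnorm (k : ι) : ‖c k‖ = 1 := by
    simpa [norm_smul] using (congrArg norm (hc k)).symm
  have hinj : Function.Injective σ := by
    intro k l hkl
    by_contra hne
    have h1 := ψ'.inner_eq_zero hne
    rw [hc k, hc l, hkl, inner_smul_left, inner_smul_right,
      OrthonormalBasis.inner_eq_one, mul_one, mul_eq_zero, map_eq_zero] at h1
    have h0 (j : ι) : c j ≠ 0 := norm_ne_zero_iff.1 (by rw [hnorm j]; exact one_ne_zero)
    exact h1.elim (h0 k) (h0 l)
  exact ⟨Equiv.ofBijective σ (Finite.injective_iff_bijective.1 hinj), c, hnorm, hc⟩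

/-! ### Maximally decohering Hamiltonians -/

/-- Accessible operators are diagonal in every control basis. -/
theorem IsControlForm.exists_eigenvalue {hH : H.IsSymmetric} (h : IsControlForm H ψ K)
    {M : Module.End ℂ S} (hM : M ∈ hamAccessible H hH) (k : ι) :
    ∃ a : ℂ, M (ψ k) = a • ψ k := by
  have := LinearMap.congr_fun
    (hM _ (hamRobust_subset (h.rankOne_mem_hamRobust k))) (ψ k)
  exact ⟨inner ℂ (ψ k) (M (ψ k)), by simpa using this.symm⟩

/-- The control basis is an eigenbasis of a decohered nondegenerate observable `M`. If some
`K k - K l` were scalar, `M` would have to commute with the matrix unit `|ψ k⟩⟨ψ l|`. -/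
theorem exists_isControlForm_of_maximallyDecohering {hH : H.IsSymmetric}
    (h : MaximallyDecohering H hH) :
    ∃ (ψ : OrthonormalBasis (Fin (Module.finrank ℂ S)) ℂ S)
      (K : Fin (Module.finrank ℂ S) → Module.End ℂ F),
      IsControlForm H ψ K ∧
      ∀ k l, k ≠ l → ¬ ∃ c : ℂ, K k - K l = c • (1 : Module.End ℂ F) := by
  obtain ⟨M, hM, hnd⟩ := h
  let ψ := hnd.1.eigenvectorBasis rfl
  have ha (k) : M (ψ k) = (hnd.1.eigenvalues rfl k : ℂ) • ψ k :=
    hnd.1.apply_eigenvectorBasis rfl k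
  have hinj := hnd.eigenvalue_injective ha
  obtain ⟨K, hK⟩ := exists_isControlForm hH hinj ha (hamDecohered_subset_hamRobust hM)
  refine ⟨ψ, K, hK, ?_⟩
  rintro k l hkl ⟨c, hc⟩
  have h1 := LinearMap.congr_fun
    (hM.1 _ (hK.rankOne_mem_hamPotentiallyAccessible (hH := hH) hc)) (ψ l)
  simp only [Module.End.mul_apply, ha, map_smul, ContinuousLinearMap.coe_coe,
    InnerProductSpace.rankOne_apply, OrthonormalBasis.inner_eq_one, one_smul] at h1
  exact hkl (hinj (smul_left_injective ℂ (ψ.orthonormal.ne_zero k) h1)).symm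

/-- If no difference of the `K k` is scalar, the potentially accessible operators are all diagonal
in the control basis, so that every diagonal observable is decohered. -/
theorem maximallyDecohering_of_isControlForm {hH : H.IsSymmetric} (h : IsControlForm H ψ K)
    (hK : ∀ k l, k ≠ l → ¬ ∃ c : ℂ, K k - K l = c • (1 : Module.End ℂ F)) :
    MaximallyDecohering H hH := by
  obtain ⟨M, hM, ha⟩ := exists_isNondegenerateObservable ψ (a := fun k => (Fintype.equivFin ι k : ℝ))
    fun k l hkl => by simpa [Fin.val_inj] using hkl
  refine ⟨M, ?_, hM⟩
  rw [hamDecohered_eq]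
  constructor
  · intro N hN
    refine ψ.toBasis.ext fun l => ?_
    have hl := eq_smul_of_inner_eq_zero ψ fun k hk => h.inner_eq_zero (hK k l hk) hN
    simp only [OrthonormalBasis.coe_toBasis, Module.End.mul_apply, ha, map_smul]
    rw [hl, map_smul, ha, smul_comm]
  · refine tensor_ext_orthonormalBasis ψ fun k x => ?_
    simp [ha, h.apply, ← TensorProduct.smul_tmul']

end Control

end

end Decoherence

theorem mainTheorem7 {S F : Type*}
    [NormedAddCommGroup S] [InnerProductSpace ℂ S] [FiniteDimensional ℂ S]
    [NormedAddCommGroup F] [InnerProductSpace ℂ F] [FiniteDimensional ℂ F]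
    (H : Module.End ℂ (S ⊗[ℂ] F)) (hH : H.IsSymmetric) :
    -- decohered = accessible and robust, where robust = invariant under the evolution
    Decoherence.hamDecohered H hH = Decoherence.hamAccessible H hH ∩ Decoherence.hamRobust H ∧
    Decoherence.hamRobust H =
      {M : Module.End ℂ S | ∀ t : ℝ,
        Decoherence.channel (Decoherence.evolution H hH t) (Decoherence.onLeft F M) =
          Decoherence.onLeft F M} ∧
    -- the form of maximally decohering Hamiltonians
    (Decoherence.MaximallyDecohering H hH ↔
      ∃ (ψ : OrthonormalBasis (Fin (Module.finrank ℂ S)) ℂ S)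
        (K : Fin (Module.finrank ℂ S) → Module.End ℂ F),
        Decoherence.IsControlForm H ψ K ∧
        ∀ k l, k ≠ l → ¬ ∃ c : ℂ, K k - K l = c • (1 : Module.End ℂ F)) ∧
    -- the control basis is unique up to phases (and the order of its elements)
    (Decoherence.MaximallyDecohering H hH →
      ∀ (ψ ψ' : OrthonormalBasis (Fin (Module.finrank ℂ S)) ℂ S)
        (K K' : Fin (Module.finrank ℂ S) → Module.End ℂ F),
        Decoherence.IsControlForm H ψ K → Decoherence.IsControlForm H ψ' K' →
        ∃ (σ : Equiv.Perm (Fin (Module.finrank ℂ S))) (c : Fin (Module.finrank ℂ S) → ℂ),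
          (∀ k, ‖c k‖ = 1) ∧ ∀ k, ψ' k = c k • ψ (σ k)) := by
  refine ⟨Decoherence.hamDecohered_eq, Set.ext fun M => Decoherence.mem_hamRobust_iff,
    ⟨Decoherence.exists_isControlForm_of_maximallyDecohering, ?_⟩, ?_⟩
  · rintro ⟨ψ, K, h, hK⟩
    exact Decoherence.maximallyDecohering_of_isControlForm h hK
  · rintro ⟨M, hM, hnd⟩ ψ ψ' K K' h h'
    choose a ha using h.exists_eigenvalue hM.1
    choose a' ha' using h'.exists_eigenvalue hM.1
    exact hnd.exists_perm ha ha'
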